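/- Let $\mathcal A$ be a unital $C^*$-algebra, $\mathcal H$ a (left) Hilbert $\mathcal A$-module with $\mathcal A$-valued inner product $\langle\cdot,\cdot\rangle$ (linear in the first variable), and $I$ a finite or countable index set. Let $K:\mathcal H\to\mathcal H$ be an adjointable operator with closed range, let $\{W_i\}_{i\in I}$ be orthogonally complemented closed submodules of $\mathcal H$ (i.e. $\mathcal H=W_i\oplus W_i^{\perp}$) with orthogonal projections $\pi_{W_i}$, let $\{w_i\}_{i\in I}$ be weights (positive invertible elements of the center of $\mathcal A$), and let $C,C'\in GL^+(\mathcal H)$ be positive bounded invertible operators on $\mathcal H$ with bounded inverses. Assume that for every $f\in\mathcal H$ the series $$\Sigma(f):=\sum_{i\in I} w_i^2\langle \pi_{W_i}Cf,\pi_{W_i}C'f\rangle$$ converges (unconditionally) in the norm of $\mathcal A$, and that $\Sigma(f)\ge 0$ for every $f\in\mathcal H$ (this holds, for instance, if every operator $C'\pi_{W_i}C$ is positive). The family $\mathcal W=\{W_i,w_i\}_{i\in I}$ is called a $(C,C')$-controlled $*$-$K$-fusion frame if there are invertible elements $A,B\in\mathcal A$ such that $$A\langle K^*f,K^*f\rangle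 A^*\ \le\ \Sigma(f)\ \le\ B\langle f,f\rangle B^*\qquad\text{for all } f\in\mathcal H .$$ Then $\mathcal W$ is a $(C,C')$-controlled $*$-$K$-fusion frame if and only if there are invertible elements $A,B\in\mathcal A$ such that $$\|A^{-1}\|^{-2}\,\|\langle K^*f,K^*f\rangle\|\ \le\ \|\Sigma(f)\|\ \le\ \|B\|^2\,\|\langle f,f\rangle\|\qquad\text{for all } f\in\mathcal H .$$ -/

import Mathlib

/-! Hilbert modules over a unital C*-algebra `𝒜`. Mathlib's `CStarModule 𝒜 H` carries an inner product
that is linear in the second variable, `inner 𝒜 x (a • y) = a * inner 𝒜 x y`. Exchanging the two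
arguments gives exactly a left Hilbert `𝒜`-module in the usual convention: `⟨a x, y⟩ = a ⟨x, y⟩`,
`⟨x, y⟩ = ⟨y, x⟩*`, with `‖x‖ = ‖⟨x, x⟩‖ ^ (1/2)`. -/

namespace HilbertModule

/-- The `𝒜`-valued inner product `⟨x, y⟩`, linear in the first variable. -/
def ip (𝒜 : Type*) {H : Type*} [Inner 𝒜 H] (x y : H) : 𝒜 := inner 𝒜 y x

section Module

variable {𝒜 H : Type*} [CStarAlgebra 𝒜] [PartialOrder 𝒜]
  [NormedAddCommGroup H] [NormedSpace ℂ H] [Module 𝒜 H] [CStarModule 𝒜 H]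

theorem ip_smul_left (a : 𝒜) (x y : H) : ip 𝒜 (a • x) y = a * ip 𝒜 x y := by
  simp [ip]

variable [StarOrderedRing 𝒜]

/-- The orthogonal complement `W⊥ = {x | ⟨x, y⟩ = 0 for all y ∈ W}`. -/
def orth (W : Submodule 𝒜 H) : Submodule 𝒜 H where
  carrier := {x | ∀ y ∈ W, ip 𝒜 x y = 0}
  zero_mem' := fun y _ => by simp [ip]
  add_mem' := fun {x x'} hx hx' y hy => by
    have h1 := hx y hy
    have h2 := hx' y hy
    simp only [ip] at h1 h2 ⊢
    simp [h1, h2]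
  smul_mem' := fun a x hx y hy => by
    rw [ip_smul_left, hx y hy, mul_zero]

/-- `W` is a closed submodule with `H = W ⊕ W⊥`. -/
structure IsOrthComplemented (W : Submodule 𝒜 H) : Prop where
  isClosed : IsClosed (W : Set H)
  isCompl : IsCompl W (orth W)

/-- The orthogonal projection `π_W` of `H` onto `W`, that is, the projection along `W⊥`. -/
noncomputable def orthProj (W : Submodule 𝒜 H) (hW : IsOrthComplemented W) : H →ₗ[𝒜] H :=
  Submodule.projection W (orth W) hW.isCompl

variable (𝒜 H) in
/-- The elements of `End*_𝒜(H)`: bounded `𝒜`-homomorphisms together with their (unique) adjoint. -/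
structure AdjointableOp where
  op : H →L[𝒜] H
  adj : H →L[𝒜] H
  ip_op_left : ∀ x y, ip 𝒜 (op x) y = ip 𝒜 x (adj y)

/-- `C ∈ GL⁺(H)`, for a bounded invertible operator `C` with bounded inverse: `C` is self-adjoint
and `⟨C x, x⟩ ≥ 0` for all `x`. -/
structure IsGLPlus (C : H ≃L[𝒜] H) : Prop where
  selfAdjoint : ∀ x y, ip 𝒜 (C x) y = ip 𝒜 x (C y)
  nonneg : ∀ x, 0 ≤ ip 𝒜 (C x) x

/-- A weight: a positive invertible element of the center of `𝒜`. -/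
structure IsWeight (a : 𝒜) : Prop where
  mem_center : a ∈ Set.center 𝒜
  nonneg : 0 ≤ a
  isUnit : IsUnit a

variable {I : Type*}

/-- The `i`-th term `w_i² ⟨π_{W_i} C f, π_{W_i} C' f⟩`. -/
noncomputable def controlledTerm (W : I → Submodule 𝒜 H) (hW : ∀ i, IsOrthComplemented (W i))
    (w : I → 𝒜) (C C' : H ≃L[𝒜] H) (f : H) (i : I) : 𝒜 :=
  w i ^ 2 * ip 𝒜 (orthProj (W i) (hW i) (C f)) (orthProj (W i) (hW i) (C' f))

/-- The `(C, C')`-controlled `*`-`K`-fusion frame property of `{W_i, w_i}`: the series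
`∑ w_i² ⟨π_{W_i} C f, π_{W_i} C' f⟩` converges in norm for every `f`, and there are
strictly nonzero (i.e. invertible) `A, B` in `𝒜` with
`A ⟨K* f, K* f⟩ A* ≤ ∑ w_i² ⟨π_{W_i} C f, π_{W_i} C' f⟩ ≤ B ⟨f, f⟩ B*` for every `f`. -/
def IsControlledStarKFusionFrame (K : AdjointableOp 𝒜 H) (W : I → Submodule 𝒜 H)
    (hW : ∀ i, IsOrthComplemented (W i)) (w : I → 𝒜) (C C' : H ≃L[𝒜] H) : Prop :=
  (∀ f, Summable (controlledTerm W hW w C C' f)) ∧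
  ∃ A B : 𝒜ˣ, ∀ f : H,
    (A : 𝒜) * ip 𝒜 (K.adj f) (K.adj f) * star (A : 𝒜) ≤ ∑' i, controlledTerm W hW w C C' f i ∧
    ∑' i, controlledTerm W hW w C C' f i ≤ (B : 𝒜) * ip 𝒜 f f * star (B : 𝒜)

end Module

end HilbertModule

namespace HilbertModule

section CStarAlgebra

variable {𝒜 : Type*} [CStarAlgebra 𝒜] [PartialOrder 𝒜] [StarOrderedRing 𝒜]

/-! Order bounds give norm bounds because the norm is monotone on positive elements. Conversely, a
norm bound at a single `f` says little, but the hypothesis holds for all of `H`, in particular at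
every `a • f`. As the weights are central, replacing `f` by `a • f` conjugates all three expressions
by `a`. So the norm inequality holds for all conjugates of two fixed positive elements, and
`le_smul_of_norm_conj_le` turns this into an order inequality. The new bounds are scalars, `‖A⁻¹‖⁻¹`
and `‖B‖`. -/

/-- A norm bound between all conjugates of two positive elements gives an order bound, up to a
positive multiple of the unit. -/
theorem le_smul_add_of_norm_conj_le {P Q : 𝒜} (hP : 0 ≤ P) (hQ : 0 ≤ Q) {c : ℝ} (hc : 0 ≤ c)
    (h : ∀ a : 𝒜, ‖a * P * star a‖ ≤ c * ‖a * Q * star a‖) {ε : ℝ} (hε : 0 < ε) :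
    P ≤ c • (Q + algebraMap ℝ 𝒜 ε) := by
  have hε0 : (0 : 𝒜) ≤ algebraMap ℝ 𝒜 ε := algebraMap_nonneg 𝒜 hε.le
  have hR : 0 ≤ Q + algebraMap ℝ 𝒜 ε := add_nonneg hQ hε0
  -- `Q` need not be invertible; the shift by `ε` is what allows an inverse square root.
  have hRu : IsUnit (Q + algebraMap ℝ 𝒜 ε) :=
    CStarAlgebra.isUnit_of_le (algebraMap ℝ 𝒜 ε) (le_add_of_nonneg_left hQ)
      (IsStrictlyPositive.iff_of_unital.2 ⟨hε0, (isUnit_iff_ne_zero.2 hε.ne').map _⟩)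
  obtain ⟨b, hb⟩ : IsUnit (CFC.sqrt (Q + algebraMap ℝ 𝒜 ε)) := (CFC.isUnit_sqrt_iff _).2 hRu
  have hbb : (b : 𝒜) * b = Q + algebraMap ℝ 𝒜 ε := by
    rw [hb, CFC.sqrt_mul_sqrt_self _ hR]
  have hbs : star (b : 𝒜) = b := by
    rw [hb]; exact (IsSelfAdjoint.of_nonneg (CFC.sqrt_nonneg _)).star_eq
  -- The test element is `a = (Q + ε)^(-1/2)`: it gives `a Q a* ≤ 1`, so `h a` yields `a P a* ≤ c`,
  -- and conjugating by `b = a⁻¹` recovers `P`.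
  set a : 𝒜 := ((b⁻¹ : 𝒜ˣ) : 𝒜) with ha
  have hab : a * b = 1 := b.inv_mul
  have hba : (b : 𝒜) * a = 1 := b.mul_inv
  have has : star a = a := by
    have h1 : (b : 𝒜) * star a = 1 := by
      rw [← hbs, ← star_mul, hab, star_one]
    calc star a = a * b * star a := by rw [hab, one_mul]
      _ = a := by rw [mul_assoc, h1, mul_one]
  have hQ1 : a * Q * star a ≤ 1 :=
    calc a * Q * star a ≤ a * (b * b) * star a :=
          star_right_conjugate_le_conjugate (hbb ▸ le_add_of_nonneg_right hε0) a
      _ = (a * b) * (b * a) := by rw [has]; simp only [mul_assoc]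
      _ = 1 := by rw [hab, hba, one_mul]
  have hQn : ‖a * Q * star a‖ ≤ 1 :=
    CStarAlgebra.norm_le_one_iff_of_nonneg _ (star_right_conjugate_nonneg hQ a) |>.2 hQ1
  have hPn : ‖a * P * star a‖ ≤ c := (h a).trans (mul_le_of_le_one_right hc hQn)
  have hPc : a * P * star a ≤ algebraMap ℝ 𝒜 c :=
    (CStarAlgebra.norm_le_iff_le_algebraMap _ hc (star_right_conjugate_nonneg hP a)).1 hPn
  calc P = (b * a) * P * (a * b) := by rw [hab, hba, one_mul, mul_one]
    _ = b * (a * P * star a) * star (b : 𝒜) := by rw [has, hbs]; simp only [mul_assoc]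
    _ ≤ b * algebraMap ℝ 𝒜 c * star (b : 𝒜) := star_right_conjugate_le_conjugate hPc _
    _ = c • (Q + algebraMap ℝ 𝒜 ε) := by
      rw [hbs, Algebra.algebraMap_eq_smul_one, mul_smul_comm, mul_one, smul_mul_assoc, hbb]

/-- A norm bound between all conjugates of two positive elements gives an order bound. -/
theorem le_smul_of_norm_conj_le {P Q : 𝒜} (hP : 0 ≤ P) (hQ : 0 ≤ Q) {c : ℝ} (hc : 0 ≤ c)
    (h : ∀ a : 𝒜, ‖a * P * star a‖ ≤ c * ‖a * Q * star a‖) : P ≤ c • Q := by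
  have hlim : Filter.Tendsto (fun ε : ℝ => c • (Q + algebraMap ℝ 𝒜 ε))
      (nhdsWithin 0 (Set.Ioi 0)) (nhds (c • Q)) := by
    have hcont : Continuous (fun ε : ℝ => c • (Q + algebraMap ℝ 𝒜 ε)) := by
      simp only [Algebra.algebraMap_eq_smul_one]
      fun_prop
    have := hcont.tendsto 0
    simp only [map_zero, add_zero] at this
    exact this.mono_left nhdsWithin_le_nhds
  exact ge_of_tendsto hlim (eventually_mem_nhdsWithin.mono fun ε hε =>
    le_smul_add_of_norm_conj_le hP hQ hc h hε)

omit [PartialOrder 𝒜] [StarOrderedRing 𝒜] in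
/-- Conjugation by a nonzero real number, as a unit of the algebra, is multiplication by its
square. -/
theorem exists_unit_conj_eq_smul (r : ℝ) (hr : r ≠ 0) :
    ∃ A : 𝒜ˣ, ∀ x : 𝒜, (A : 𝒜) * x * star (A : 𝒜) = r ^ 2 • x := by
  refine ⟨Units.map (algebraMap ℝ 𝒜).toMonoidHom (Units.mk0 r hr), fun x => ?_⟩
  simp [Algebra.algebraMap_eq_smul_one, smul_smul, sq]

omit [PartialOrder 𝒜] [StarOrderedRing 𝒜] in
theorem norm_conj_le (a x : 𝒜) : ‖a * x * star a‖ ≤ ‖a‖ ^ 2 * ‖x‖ :=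
  calc ‖a * x * star a‖ ≤ ‖a‖ * ‖x‖ * ‖star a‖ := norm_mul₃_le
    _ = ‖a‖ ^ 2 * ‖x‖ := by rw [norm_star]; ring

omit [PartialOrder 𝒜] [StarOrderedRing 𝒜] in
theorem norm_le_norm_inv_sq_mul_norm_conj (A : 𝒜ˣ) (x : 𝒜) :
    ‖x‖ ≤ ‖((A⁻¹ : 𝒜ˣ) : 𝒜)‖ ^ 2 * ‖(A : 𝒜) * x * star (A : 𝒜)‖ := by
  have hs : star (A : 𝒜) * star ((A⁻¹ : 𝒜ˣ) : 𝒜) = 1 := by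
    rw [← star_mul, A.inv_mul, star_one]
  have hx : ((A⁻¹ : 𝒜ˣ) : 𝒜) * ((A : 𝒜) * x * star (A : 𝒜)) * star ((A⁻¹ : 𝒜ˣ) : 𝒜) = x := by
    calc _ = (((A⁻¹ : 𝒜ˣ) : 𝒜) * A) * x * (star (A : 𝒜) * star ((A⁻¹ : 𝒜ˣ) : 𝒜)) := by
          simp only [mul_assoc]
      _ = x := by rw [hs, A.inv_mul, one_mul, mul_one]
  simpa only [hx] using norm_conj_le ((A⁻¹ : 𝒜ˣ) : 𝒜) ((A : 𝒜) * x * star (A : 𝒜))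

end CStarAlgebra

section Module

variable {𝒜 H I : Type*} [CStarAlgebra 𝒜] [PartialOrder 𝒜] [StarOrderedRing 𝒜]
  [NormedAddCommGroup H] [NormedSpace ℂ H] [Module 𝒜 H] [CStarModule 𝒜 H]

omit [StarOrderedRing 𝒜] in
theorem ip_smul_smul (a : 𝒜) (x y : H) : ip 𝒜 (a • x) (a • y) = a * ip 𝒜 x y * star a := by
  simp [ip, mul_assoc]

omit [StarOrderedRing 𝒜] in
theorem ip_self_nonneg (x : H) : 0 ≤ ip 𝒜 x x := CStarModule.inner_self_nonneg

/-- The projections, `C` and `C'` are `𝒜`-linear, and the central `w i ^ 2` commutes past `a`. -/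
theorem controlledTerm_smul {W : I → Submodule 𝒜 H} {hW : ∀ i, IsOrthComplemented (W i)}
    {w : I → 𝒜} (hw : ∀ i, IsWeight (w i)) (C C' : H ≃L[𝒜] H) (a : 𝒜) (f : H) (i : I) :
    controlledTerm W hW w C C' (a • f) i = a * controlledTerm W hW w C C' f i * star a := by
  have hcomm : w i ^ 2 * a = a * w i ^ 2 :=
    ((show Commute (w i) a from (hw i).mem_center.comm a).pow_left 2).eq
  simp only [controlledTerm, map_smul, ip_smul_smul]
  simp only [← mul_assoc, hcomm]

theorem tsum_controlledTerm_smul {W : I → Submodule 𝒜 H} {hW : ∀ i, IsOrthComplemented (W i)}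
    {w : I → 𝒜} (hw : ∀ i, IsWeight (w i)) {C C' : H ≃L[𝒜] H} {f : H}
    (hf : Summable (controlledTerm W hW w C C' f)) (a : 𝒜) :
    ∑' i, controlledTerm W hW w C C' (a • f) i =
      a * (∑' i, controlledTerm W hW w C C' f i) * star a := by
  simp only [controlledTerm_smul hw]
  rw [(hf.mul_left a).tsum_mul_right, hf.tsum_mul_left]

end Module

end HilbertModule

theorem mainTheorem5 {𝒜 H I : Type*} [CStarAlgebra 𝒜] [PartialOrder 𝒜] [StarOrderedRing 𝒜]
    [NormedAddCommGroup H] [NormedSpace ℂ H] [Module 𝒜 H] [CStarModule 𝒜 H] [CompleteSpace H]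
    [Countable I]
    (K : HilbertModule.AdjointableOp 𝒜 H) (hK : IsClosed (Set.range K.op))
    (W : I → Submodule 𝒜 H) (hW : ∀ i, HilbertModule.IsOrthComplemented (W i))
    (w : I → 𝒜) (hw : ∀ i, HilbertModule.IsWeight (w i))
    (C C' : H ≃L[𝒜] H) (hC : HilbertModule.IsGLPlus C) (hC' : HilbertModule.IsGLPlus C')
    (hsum : ∀ f, Summable (HilbertModule.controlledTerm W hW w C C' f))
    (hpos : ∀ f, 0 ≤ ∑' i, HilbertModule.controlledTerm W hW w C C' f i) :
    HilbertModule.IsControlledStarKFusionFrame K W hW w C C' ↔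
      ∃ A B : 𝒜ˣ, ∀ f : H,
        ‖((A⁻¹ : 𝒜ˣ) : 𝒜)‖⁻¹ ^ 2 * ‖HilbertModule.ip 𝒜 (K.adj f) (K.adj f)‖ ≤
          ‖∑' i, HilbertModule.controlledTerm W hW w C C' f i‖ ∧
        ‖∑' i, HilbertModule.controlledTerm W hW w C C' f i‖ ≤
          ‖(B : 𝒜)‖ ^ 2 * ‖HilbertModule.ip 𝒜 f f‖ := by 
  open HilbertModule in
  constructor
  · rintro ⟨-, A, B, h⟩
    refine ⟨A, B, fun f => ⟨?_, ?_⟩⟩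
    · have h1 := norm_le_norm_inv_sq_mul_norm_conj A (ip 𝒜 (K.adj f) (K.adj f))
      have h2 := CStarAlgebra.norm_le_norm_of_nonneg_of_le
        (star_right_conjugate_nonneg (ip_self_nonneg (K.adj f)) (A : 𝒜)) (h f).1
      rw [inv_pow]
      exact inv_mul_le_of_le_mul₀ (by positivity) (norm_nonneg _)
        (h1.trans (mul_le_mul_of_nonneg_left h2 (by positivity)))
    · exact (CStarAlgebra.norm_le_norm_of_nonneg_of_le (hpos f) (h f).2).trans
        (norm_conj_le _ _)
  · rintro ⟨A, B, h⟩
    refine ⟨hsum, ?_⟩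
    -- In the zero algebra `‖A⁻¹‖` and `‖B‖` vanish and give no invertible scalars.
    rcases subsingleton_or_nontrivial 𝒜 with _ | _
    · exact ⟨1, 1, fun f => ⟨(Subsingleton.elim _ _).le, (Subsingleton.elim _ _).le⟩⟩
    have hA : 0 < ‖((A⁻¹ : 𝒜ˣ) : 𝒜)‖ := norm_pos_iff.2 (A⁻¹).ne_zero
    have hB : 0 < ‖(B : 𝒜)‖ := norm_pos_iff.2 B.ne_zero
    obtain ⟨A', hA'⟩ := exists_unit_conj_eq_smul (𝒜 := 𝒜) _ (inv_pos.2 hA).ne'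
    obtain ⟨B', hB'⟩ := exists_unit_conj_eq_smul (𝒜 := 𝒜) _ hB.ne'
    refine ⟨A', B', fun f => ⟨?_, ?_⟩⟩
    -- Here `c = 1`: the factor `‖A⁻¹‖⁻¹ ^ 2` is absorbed into `P`.
    · have := le_smul_of_norm_conj_le
        (smul_nonneg (sq_nonneg ‖((A⁻¹ : 𝒜ˣ) : 𝒜)‖⁻¹) (ip_self_nonneg (K.adj f)))
        (hpos f) zero_le_one fun a => ?_
      · rwa [hA', ← one_smul ℝ (∑' i, _)]
      · have := (h (a • f)).1
        rw [tsum_controlledTerm_smul hw (hsum f), map_smul, ip_smul_smul] at this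
        rwa [mul_smul_comm, smul_mul_assoc, norm_smul, one_mul,
          Real.norm_of_nonneg (sq_nonneg _)]
    · rw [hB']
      refine le_smul_of_norm_conj_le (hpos f) (ip_self_nonneg f) (sq_nonneg _) fun a => ?_
      have := (h (a • f)).2
      rwa [tsum_controlledTerm_smul hw (hsum f), ip_smul_smul] at this
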